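/- All rings are commutative with unit. A morphism of schemes is a \emph{universal homeomorphism} if all of its base changes are homeomorphisms on underlying topological spaces; a ring map $R \to S$ is called a universal homeomorphism if $\operatorname{Spec} S \to \operatorname{Spec} R$ is one. A commutative square of schemes with morphisms $p \colon Y \to X$, $g \colon Y \to Y'$, $f \colon X \to X'$, $q \colon Y' \to X'$ (so $f \circ p = q \circ g$) is a \emph{geometric pushout square}, and $X'$ is called the geometric pushout of $X \xleftarrow{p} Y \xrightarrow{g} Y'$, if $p$ is quasi-compact and quasi-separated, $g$ and $f$ are universal homeomorphisms, and the natural map $$\mathcal{O}_{X'} \to f_*\mathcal{O}_X \times_{(f\circ p)_*\mathcal{O}_Y} q_*\mathcal{O}_{Y'}$$ is an isomorphism of sheaves of rings on $X'$. \textbf{Proposition.} Let $B$ be a ring, put $B' := B \otimes_{\mathbb{Z}} \mathbb{Q}$ with canonical map $i \colon B \to B'$, $b \mapsto b \otimes 1$, and let $j \colon A' \to B'$ be a homomorphism of $\mathbb{Q}$-algebras which is a universal homeomorphism. Let $A := B \times_{B'} A' = \{(b,a') \in B \times A' : i(b) = j(a')\}$. Then the projection $A \to B$ is a universal homeomorphism.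 Moreover, the square formed by $\operatorname{Spec} B' \to \operatorname{Spec} B$, $\operatorname{Spec} B' \to \operatorname{Spec} A'$, $\operatorname{Spec} B \to \operatorname{Spec} A$ and $\operatorname{Spec} A' \to \operatorname{Spec} A$ is a geometric pushout square, i.e. $\operatorname{Spec} A$ is the geometric pushout of $\operatorname{Spec} B \leftarrow \operatorname{Spec} B' \to \operatorname{Spec} A'$. -/

import Mathlib

open CategoryTheory AlgebraicGeometry
open scoped TensorProduct

universe u

/-- A morphism of schemes is a universal homeomorphism if every base change of it
is a homeomorphism on underlying topological spaces. -/
def IsUniversalHomeomorphism {X Y : Scheme.{u}} (f : X ⟶ Y) : Prop :=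
  (AlgebraicGeometry.topologically fun {_ _} _ _ g => IsHomeomorph g).universally f

/-- A square of schemes, with `p : Y ⟶ X`, `g : Y ⟶ Y'`, `f : X ⟶ X'` and `q : Y' ⟶ X'`,
is a topological pushout square if it commutes, `p` is quasi-compact and quasi-separated,
and `g` and `f` are universal homeomorphisms. (Representability is automatic for schemes.) -/
structure IsTopologicalPushoutSquare {X Y X' Y' : Scheme.{u}}
    (p : Y ⟶ X) (g : Y ⟶ Y') (f : X ⟶ X') (q : Y' ⟶ X') : Prop where
  comm : p ≫ f = g ≫ q
  quasiCompact : QuasiCompact p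
  quasiSeparated : QuasiSeparated p
  left_univHomeo : IsUniversalHomeomorphism g
  right_univHomeo : IsUniversalHomeomorphism f

/-- A topological pushout square is a geometric pushout square if the natural map from
`𝒪_{X'}` to `f_* 𝒪_X ×_{(f ∘ p)_* 𝒪_Y} q_* 𝒪_{Y'}` is an isomorphism, that is, if
for each open `U` of `X'` the square of sections over the preimages of `U`
is a pullback square of rings. -/
structure IsGeometricPushoutSquare {X Y X' Y' : Scheme.{u}}
    (p : Y ⟶ X) (g : Y ⟶ Y') (f : X ⟶ X') (q : Y' ⟶ X') : Prop
    extends IsTopologicalPushoutSquare p g f q where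
  isPullback_sections : ∀ U : X'.Opens,
    IsPullback (f.app U) (q.app U)
      (p.app (f ⁻¹ᵁ U))
      (g.appLE (q ⁻¹ᵁ U) (p ⁻¹ᵁ f ⁻¹ᵁ U)
        (by rw [← Scheme.Hom.comp_preimage, ← Scheme.Hom.comp_preimage, comm]))

/-- The fibre product `R ×_T S` of commutative rings, as the subring of `R × S` of the pairs
`(r, s)` with `φ r = ψ s`. -/
def ringFibreProduct {R S T : Type u} [CommRing R] [CommRing S] [CommRing T]
    (φ : R →+* T) (ψ : S →+* T) : Subring (R × S) :=
  (φ.comp (RingHom.fst R S)).eqLocus (ψ.comp (RingHom.snd R S))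

/-- The first projection `R ×_T S → R`. -/
def ringFibreProductFst {R S T : Type u} [CommRing R] [CommRing S] [CommRing T]
    (φ : R →+* T) (ψ : S →+* T) : ringFibreProduct φ ψ →+* R :=
  (RingHom.fst R S).comp (ringFibreProduct φ ψ).subtype

/-- The second projection `R ×_T S → S`. -/
def ringFibreProductSnd {R S T : Type u} [CommRing R] [CommRing S] [CommRing T]
    (φ : R →+* T) (ψ : S →+* T) : ringFibreProduct φ ψ →+* S :=
  (RingHom.snd R S).comp (ringFibreProduct φ ψ).subtype

/-- The canonical map `B → B ⊗ ℚ`, `b ↦ b ⊗ 1`. -/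
def toRationalization (B : Type u) [CommRing B] : B →+* B ⊗[ℤ] ℚ :=
  Algebra.TensorProduct.includeLeftRingHom

/-! `A → B` is a universal homeomorphism once it is integral, injective on field-valued points, and
has nil kernel. The kernel consists of pairs `(0, a)` with `j a = 0`, so it is nil because `ker j`
is. For the rest, climb from `j(A')` to `B' = B ⊗ ℚ` by steps `D ⊂ D[x]` with `x ^ 2, x ^ 3 ∈ D`.
Zorn's lemma gives a maximal subring `D ⊇ j(A')` such that every `b` with `i b ∈ D` is integral over
`A` and has its value at a field-valued point determined by the restriction to `A`. Such a step
preserves this property (`isIntegral_of_add_mem`, `eq_of_add_mem`): modulo multiples of `c ^ 2`, `(b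
+ c) ^ n` is `b ^ n + n * c * b ^ (n - 1)`, and `n` can be chosen to clear the denominator of `c`.
Hence `D` is seminormal in `B'`, and `Subring.eq_top_of_seminormal` gives `D = B'`; characteristic
zero enters there through residue fields.

The sheaf condition holds on basic opens because localization preserves fibre products of rings, and
it extends to all opens by gluing. -/

/-! ### Adjoining an element with square in the subring; residue fields; an integrality criterion.
-/

theorem exists_eq_add_mul_of_mem_closure_insert {R : Type*} [CommRing R] (D : Subring R) {x : R}
    (hx : x ^ 2 ∈ D) {y : R} (hy : y ∈ Subring.closure (insert x (D : Set R))) :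
    ∃ α ∈ D, ∃ β ∈ D, y = α + β * x := by
  induction hy using Subring.closure_induction with
  | mem z hz =>
    rcases hz with rfl | hz
    · exact ⟨0, D.zero_mem, 1, D.one_mem, by ring⟩
    · exact ⟨z, hz, 0, D.zero_mem, by ring⟩
  | zero => exact ⟨0, D.zero_mem, 0, D.zero_mem, by ring⟩
  | one => exact ⟨1, D.one_mem, 0, D.zero_mem, by ring⟩
  | add y z _ _ hy hz =>
    obtain ⟨α, hα, β, hβ, rfl⟩ := hy
    obtain ⟨γ, hγ, δ, hδ, rfl⟩ := hz
    exact ⟨α + γ, D.add_mem hα hγ, β + δ, D.add_mem hβ hδ, by ring⟩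
  | neg y _ hy =>
    obtain ⟨α, hα, β, hβ, rfl⟩ := hy
    exact ⟨-α, D.neg_mem hα, -β, D.neg_mem hβ, by ring⟩
  | mul y z _ _ hy hz =>
    obtain ⟨α, hα, β, hβ, rfl⟩ := hy
    obtain ⟨γ, hγ, δ, hδ, rfl⟩ := hz
    exact ⟨α * γ + β * δ * x ^ 2,
      D.add_mem (D.mul_mem hα hγ) (D.mul_mem (D.mul_mem hβ hδ) hx),
      α * δ + β * γ, D.add_mem (D.mul_mem hα hδ) (D.mul_mem hβ hγ), by ring⟩

/-- The residue field extensions of an extension of `ℚ`-algebras that is injective on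
points with values in fields are trivial. -/
theorem exists_mul_sub_mem_of_injective_fieldPoints {B : Type u} [CommRing B] [Algebra ℚ B]
    (D : Subring B)
    (hres : ∀ (K : Type u) [Field K] (f g : B →+* K), (∀ x ∈ D, f x = g x) → f = g)
    (Q : Ideal B) [Q.IsPrime] (b : B) :
    ∃ s ∈ D, s ∉ Q ∧ ∃ a ∈ D, s * b - a ∈ Q := by
  let F := FractionRing (B ⧸ Q)
  let π : B →+* F := (algebraMap (B ⧸ Q) F).comp (Ideal.Quotient.mk Q)
  have hπ : ∀ x, π x = 0 ↔ x ∈ Q := fun x ↦ by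
    simp [π, Ideal.Quotient.eq_zero_iff_mem]
  let k : Subfield F := Subfield.closure (D.map π : Set F)
  have hk : ∀ x ∈ D, π x ∈ k := fun x hx ↦ Subfield.subset_closure ⟨x, hx, rfl⟩
  have hchar : CharZero F := by
    let := (π.comp (algebraMap ℚ B)).toAlgebra
    exact algebraRat.charZero F
  -- Two `k`-embeddings of `F` into its algebraic closure agree on `D`, hence coincide; in
  -- characteristic zero, purely inseparable then forces `F = k`.
  have hpi : IsPurelyInseparable k F := by
    rw [isPurelyInseparable_iff_subsingleton_emb, subsingleton_iff]
    intro σ τ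
    apply AlgHom.coe_ringHom_injective
    apply IsLocalization.ringHom_ext (nonZeroDivisors (B ⧸ Q))
    apply Ideal.Quotient.ringHom_ext
    refine hres _ _ _ fun x hx ↦ ?_
    exact (σ.commutes ⟨π x, hk x hx⟩).trans (τ.commutes ⟨π x, hk x hx⟩).symm
  obtain ⟨⟨z, hz⟩, hzb⟩ := IsPurelyInseparable.surjective_algebraMap_of_isSeparable k F (π b)
  change z = π b at hzb
  subst hzb
  obtain ⟨a, ha, s, hs, h⟩ := Subfield.mem_closure_iff.mp hz
  rw [Subring.closure_eq] at ha hs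
  obtain ⟨a, ha, rfl⟩ := ha
  obtain ⟨s, hs, rfl⟩ := hs
  -- If `π s = 0`, division by zero returns `0`, so `π b = 0` and `b` itself lies in `Q`.
  by_cases h0 : π s = 0
  · refine ⟨1, D.one_mem, ?_, 0, D.zero_mem, ?_⟩
    · exact fun h ↦ Ideal.IsPrime.ne_top ‹_› ((Ideal.eq_top_iff_one _).mpr h)
    · rw [h0, div_zero] at h
      simpa [← hπ] using h.symm
  · refine ⟨s, hs, fun h ↦ h0 ((hπ s).mpr h), a, ha, ?_⟩
    rw [← hπ, map_sub, map_mul, ← h]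
    rw [mul_div_cancel₀ _ h0, sub_self]

/-- The relation is a monic equation for `b` over the integral closure, since `2 * N < 2 * (N + 1)`.
-/
theorem isIntegral_of_sq_pow_sub_eq {A B : Type*} [CommRing A] [CommRing B] [Algebra A B]
    {a b e : B} {N : ℕ} (ha : IsIntegral A a) (he : IsIntegral A e)
    (h : (b ^ (N + 1) - a) ^ 2 = e * b ^ (2 * N)) : IsIntegral A b := by
  rcases subsingleton_or_nontrivial B with hB | hB
  · rw [Subsingleton.elim b 0]
    exact isIntegral_zero
  let C := integralClosure A B
  have : IsIntegral C b := by
    refine ⟨(Polynomial.X ^ (N + 1) - Polynomial.C ⟨a, ha⟩) ^ 2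
      - Polynomial.C ⟨e, he⟩ * Polynomial.X ^ (2 * N), ?_, ?_⟩
    · have hm : ((Polynomial.X ^ (N + 1) - Polynomial.C (⟨a, ha⟩ : C)) ^ 2).Monic :=
        (Polynomial.monic_X_pow_sub_C _ N.succ_ne_zero).pow 2
      refine hm.sub_of_left ((Polynomial.degree_C_mul_X_pow_le _ _).trans_lt ?_)
      rw [Polynomial.degree_eq_natDegree hm.ne_zero,
        (Polynomial.monic_X_pow_sub_C _ N.succ_ne_zero).natDegree_pow,
        Polynomial.natDegree_X_pow_sub_C]
      exact_mod_cast by omega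
    · have : (algebraMap C B) ⟨a, ha⟩ = a := rfl
      have : (algebraMap C B) ⟨e, he⟩ = e := rfl
      simp [*]
  exact isIntegral_trans b this

/-! ### Elementary steps `D ⊂ D[x]` with `x ^ 2, x ^ 3 ∈ D`. -/

section Elementary

variable {R : Type*} [CommRing R] {D : Subring R} {b c : R}

theorem sq_mul_pow_mem_and_cube_mul_pow_mem (h2 : c ^ 2 ∈ D) (h3 : c ^ 3 ∈ D) (hbc : b + c ∈ D)
    (n : ℕ) : c ^ 2 * b ^ n ∈ D ∧ c ^ 3 * b ^ n ∈ D := by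
  induction n with
  | zero => simpa using ⟨h2, h3⟩
  | succ n ih =>
    constructor
    · have : c ^ 2 * b ^ (n + 1) = (b + c) * (c ^ 2 * b ^ n) - c ^ 3 * b ^ n := by ring
      rw [this]
      exact D.sub_mem (D.mul_mem hbc ih.1) ih.2
    · have : c ^ 3 * b ^ (n + 1) = (b + c) * (c ^ 3 * b ^ n) - c ^ 2 * (c ^ 2 * b ^ n) := by ring
      rw [this]
      exact D.sub_mem (D.mul_mem hbc ih.2) (D.mul_mem h2 ih.1)

/-- This is the part of `(b + c) ^ (n + 1)` of degree at most one in `c`; the discarded terms are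
multiples of `c ^ 2`, handled by the preceding lemma. -/
theorem pow_succ_add_mul_pow_mem (h2 : c ^ 2 ∈ D) (h3 : c ^ 3 ∈ D) (hbc : b + c ∈ D) (n : ℕ) :
    b ^ (n + 1) + (n + 1 : ℕ) * c * b ^ n ∈ D := by
  induction n with
  | zero => simpa using hbc
  | succ n ih =>
    have : b ^ (n + 1 + 1) + (n + 1 + 1 : ℕ) * c * b ^ (n + 1) =
        (b + c) * (b ^ (n + 1) + (n + 1 : ℕ) * c * b ^ n)
          - (n + 1 : ℕ) * (c ^ 2 * b ^ n) := by
      push_cast; ring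
    rw [this]
    exact D.sub_mem (D.mul_mem hbc ih)
      (D.mul_mem (natCast_mem D _) (sq_mul_pow_mem_and_cube_mul_pow_mem h2 h3 hbc n).1)

end Elementary

theorem eq_of_sq_eq_sq_of_cube_eq_cube {K : Type*} [CommRing K] [IsReduced K] {x y : K}
    (h2 : x ^ 2 = y ^ 2) (h3 : x ^ 3 = y ^ 3) : x = y := by
  have : (x - y) ^ 3 = 0 := by linear_combination 4 * h3 - 3 * (x + y) * h2
  exact sub_eq_zero.mp (eq_zero_of_pow_eq_zero this)

section ElementaryStep

variable {B B' : Type*} [CommRing B] [CommRing B'] {i : B →+* B'} {D : Subring B'} {b : B} {c : B'}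

theorem isIntegral_of_add_mem {A : Type*} [CommRing A] [Algebra A B]
    (hi : ∀ x : B', ∃ n : ℕ, n ≠ 0 ∧ ∃ b, i b = n * x)
    (hD : ∀ x, i x ∈ D → IsIntegral A x)
    (h2 : c ^ 2 ∈ D) (h3 : c ^ 3 ∈ D) (hbc : i b + c ∈ D) : IsIntegral A b := by
  obtain ⟨n, hn, e, he⟩ := hi c
  obtain ⟨n, rfl⟩ := Nat.exists_eq_succ_of_ne_zero hn
  -- Here `e` stands for `(n + 1) * c`, so `a` maps to the element of `pow_succ_add_mul_pow_mem`.
  refine isIntegral_of_sq_pow_sub_eq (a := b ^ (n + 1) + e * b ^ n) (e := e ^ 2) (N := n)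
    (hD _ ?_) (hD _ ?_) (by ring)
  · simpa [he] using pow_succ_add_mul_pow_mem h2 h3 hbc n
  · rw [map_pow, he, mul_pow]
    exact D.mul_mem (D.pow_mem (natCast_mem D _) 2) h2

theorem eq_of_add_mem {K : Type*} [Field K] {f g : B →+* K}
    (hi : ∀ x : B', ∃ n : ℕ, n ≠ 0 ∧ ∃ b, i b = n * x)
    (hD : ∀ x, i x ∈ D → f x = g x)
    (h2 : c ^ 2 ∈ D) (h3 : c ^ 3 ∈ D) (hbc : i b + c ∈ D) : f b = g b := by
  obtain ⟨n, hn, e, he⟩ := hi c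
  obtain ⟨p, hp⟩ := CharP.exists K
  rcases CharP.char_is_prime_or_zero K p with hp' | rfl
  · obtain ⟨r, v, hv, rfl⟩ := Nat.exists_eq_pow_mul_and_not_dvd hn p hp'.ne_one
    have : Fact p.Prime := ⟨hp'⟩
    have hv0 : (v : K) ≠ 0 := by rwa [Ne, CharP.cast_eq_zero_iff K p]
    have hpow : 0 < p ^ (r + 1) := pow_pos hp'.pos _
    have hv2 : ((v : B') * c) ^ 2 ∈ D := by
      rw [mul_pow]; exact D.mul_mem (D.pow_mem (natCast_mem D _) 2) h2
    have hv3 : ((v : B') * c) ^ 3 ∈ D := by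
      rw [mul_pow]; exact D.mul_mem (D.pow_mem (natCast_mem D _) 3) h3
    have hvbc : i (v * b) + v * c ∈ D := by
      rw [map_mul, map_natCast, ← mul_add]; exact D.mul_mem (natCast_mem D _) hbc
    -- With one more factor `p` than in the denominator `p ^ r * v`, the linear term `p ^ (r + 1) *
    -- v * c` is `i (p * e)`, which dies in `K`; a power of Frobenius remains.
    have key := pow_succ_add_mul_pow_mem hv2 hv3 hvbc (p ^ (r + 1) - 1)
    rw [Nat.sub_add_cancel hpow] at key
    have : i ((v * b) ^ (p ^ (r + 1)) + p * e * (v * b) ^ (p ^ (r + 1) - 1)) ∈ D := by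
      convert key using 1
      rw [map_add, map_mul, map_mul, map_pow, map_pow, he, map_natCast]
      push_cast
      ring
    have h := hD _ this
    simp only [map_add, map_mul, map_pow, map_natCast, CharP.cast_eq_zero, zero_mul,
      add_zero] at h
    exact mul_left_cancel₀ hv0 (iterateFrobenius_inj K p (r + 1)
      (by simpa only [iterateFrobenius_def] using h))
  · have : CharZero K := CharP.charP_to_charZero K
    have he2 : f (e ^ 2) = g (e ^ 2) := hD _ (by
      rw [map_pow, he, mul_pow]; exact D.mul_mem (D.pow_mem (natCast_mem D _) 2) h2)
    have he3 : f (e ^ 3) = g (e ^ 3) := hD _ (by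
      rw [map_pow, he, mul_pow]; exact D.mul_mem (D.pow_mem (natCast_mem D _) 3) h3)
    rw [map_pow, map_pow] at he2 he3
    have hee := eq_of_sq_eq_sq_of_cube_eq_cube he2 he3
    have h : f (n * b + e) = g (n * b + e) := hD _ (by
      rw [map_add, map_mul, map_natCast, he, ← mul_add]; exact D.mul_mem (natCast_mem D _) hbc)
    simp only [map_add, map_mul, map_natCast, hee, add_left_inj] at h
    exact mul_left_cancel₀ (Nat.cast_ne_zero.mpr hn) h

end ElementaryStep

/-! ### Seminormal subrings and the Zorn argument. -/

theorem exists_pow_mul_mem_of_fg {R : Type*} [CommRing R] {D : Subring R} {s : R} (hs : s ∈ D)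
    {M : Submodule D R} (hM : M.FG) (h : ∀ y ∈ M, ∃ n : ℕ, s ^ n * y ∈ D) :
    ∃ n : ℕ, ∀ y ∈ M, s ^ n * y ∈ D := by
  obtain ⟨T, rfl⟩ := hM
  have hT : ∀ y ∈ T, ∃ n : ℕ, s ^ n * y ∈ D := fun y hy ↦ h y (Submodule.subset_span hy)
  choose! n hn using hT
  refine ⟨T.sup n, fun y hy ↦ ?_⟩
  induction hy using Submodule.span_induction with
  | mem y hy =>
    rw [← Nat.sub_add_cancel (Finset.le_sup (f := n) hy), pow_add, mul_assoc]
    exact D.mul_mem (D.pow_mem hs _) (hn y hy)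
  | zero => simp
  | add y z _ _ hy hz => rw [mul_add]; exact D.add_mem hy hz
  | smul a y _ hy =>
    rw [mul_smul_comm]
    exact D.mul_mem a.2 hy

/-- A subring `D` of a `ℚ`-algebra `B` over which `B` is integral, with the same spectrum and
trivial residue field extensions, is `B` as soon as it is seminormal in `B`. -/
theorem Subring.eq_top_of_seminormal {B : Type u} [CommRing B] [Algebra ℚ B]
    (D : Subring B) (hint : ∀ b : B, IsIntegral D b)
    (hspec : ∀ P Q : Ideal B, P.IsPrime → Q.IsPrime → (∀ x ∈ D, x ∈ P ↔ x ∈ Q) → P = Q)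
    (hres : ∀ (K : Type u) [Field K] (f g : B →+* K), (∀ x ∈ D, f x = g x) → f = g)
    (hsn : ∀ x, x ^ 2 ∈ D → x ^ 3 ∈ D → x ∈ D) : D = ⊤ := by
  rw [eq_top_iff]
  intro b _
  by_contra hb
  have : Algebra.IsIntegral D B := ⟨hint⟩
  let S : Subalgebra D B := Algebra.adjoin D {b}
  have hbS : b ∈ S := Algebra.subset_adjoin rfl
  have hDS : ∀ x ∈ D, x ∈ S := fun x hx ↦ S.algebraMap_mem ⟨x, hx⟩
  -- The conductor of `D` in `S = D[b]`.
  let J : Ideal S :=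
    { carrier := {x | ∀ y ∈ S, (x : B) * y ∈ D}
      zero_mem' := fun y _ ↦ by simp
      add_mem' := fun {x z} hx hz y hy ↦ by
        simpa [add_mul] using D.add_mem (hx y hy) (hz y hy)
      smul_mem' := fun s x hx y hy ↦ by
        have := hx (s * y) (S.mul_mem s.2 hy)
        have e : ((s • x : S) : B) * y = x * (s * y) := by
          simp only [smul_eq_mul, MulMemClass.coe_mul]; ring
        rwa [e] }
  have hJ : ∀ x : S, x ∈ J ↔ ∀ y ∈ S, (x : B) * y ∈ D := fun _ ↦ Iff.rfl
  have hJrad : J.IsRadical := by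
    rw [Ideal.isRadical_iff_quotient_reduced, isReduced_iff_pow_one_lt 2 one_lt_two]
    intro x hx
    obtain ⟨x, rfl⟩ := Ideal.Quotient.mk_surjective x
    rw [← map_pow, Ideal.Quotient.eq_zero_iff_mem, hJ] at hx
    rw [Ideal.Quotient.eq_zero_iff_mem, hJ]
    intro y hy
    -- With `x ^ 2 ∈ J`, both `(x * y) ^ 2` and `(x * y) ^ 3 = x ^ 2 * (x * y ^ 3)` lie in `D`.
    refine hsn _ ?_ ?_
    · have := hx (y ^ 2) (S.pow_mem hy 2)
      rwa [mul_pow]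
    · have := hx (x * y ^ 3) (S.mul_mem x.2 (S.pow_mem hy 3))
      convert this using 1
      simp only [SubmonoidClass.coe_pow]
      ring
  let I : Ideal D := J.comap (algebraMap D S)
  have hI : ∀ x : D, x ∈ I ↔ ∀ y ∈ S, (x : B) * y ∈ D := fun _ ↦ Iff.rfl
  have hItop : I ≠ ⊤ := fun h ↦ hb (by
    have := (hI 1).mp ((Ideal.eq_top_iff_one I).mp h) b hbS
    simpa using this)
  obtain ⟨M, hM, hIM⟩ := Ideal.exists_le_maximal I hItop
  obtain ⟨P, hP, -⟩ := Ideal.exists_minimalPrimes_le hIM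
  have hPp : P.IsPrime := hP.1.1
  obtain ⟨Q, -, hQ, hQP⟩ := Ideal.exists_ideal_over_prime_of_isIntegral (S := B) P ⊥ (by
    rw [Ideal.comap_bot_of_injective _ Subtype.val_injective]; exact bot_le)
  obtain ⟨s, hs, hsQ, a, ha, hx⟩ := exists_mul_sub_mem_of_injective_fieldPoints D hres Q b
  let x : S := ⟨s * b - a, S.sub_mem (S.mul_mem (hDS s hs) hbS) (hDS a ha)⟩
  -- Away from `P`, `x` is nilpotent modulo `J`: a prime `q ⊇ J` contracting into `P` contracts to
  -- `P` by minimality, so it is the trace of the only prime `Q` over `P`, and `x ∈ Q`.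
  obtain ⟨t, ht, n, htx⟩ : ∃ t : D, t ∉ P ∧ ∃ n : ℕ, algebraMap D S t * x ^ n ∈ J := by
    by_contra! hcon
    have hdisj : Disjoint (J : Set S)
        ((P.primeCompl.map (algebraMap D S) ⊔ Submonoid.powers x : Submonoid S) : Set S) := by
      rw [Set.disjoint_left]
      intro z hzJ hz
      obtain ⟨_, ⟨t, ht, rfl⟩, _, ⟨n, rfl⟩, rfl⟩ := Submonoid.mem_sup.mp hz
      exact hcon t ht n hzJ
    obtain ⟨q, hq, hJq, hdq⟩ := Ideal.exists_le_prime_disjoint J _ hdisj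
    have hqP : q.comap (algebraMap D S) = P := by
      have hle : q.comap (algebraMap D S) ≤ P := fun z hz ↦ by
        by_contra hzP
        exact Set.disjoint_left.mp hdq hz (Submonoid.mem_sup_left ⟨z, hzP, rfl⟩)
      exact le_antisymm hle (hP.2 ⟨inferInstance, Ideal.comap_mono hJq⟩ hle)
    have : Algebra.IsIntegral S B := Algebra.IsIntegral.tower_top D
    obtain ⟨Q', -, hQ', hQq⟩ := Ideal.exists_ideal_over_prime_of_isIntegral (S := B) q ⊥ (by
      rw [Ideal.comap_bot_of_injective _ Subtype.val_injective]; exact bot_le)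
    have hQQ : Q' = Q := hspec _ _ hQ' hQ fun z hz ↦ by
      have h1 : z ∈ Q ↔ (⟨z, hz⟩ : D) ∈ P := by rw [← hQP]; rfl
      have h2 : z ∈ Q' ↔ (⟨z, hz⟩ : D) ∈ P := by rw [← hqP, ← hQq]; rfl
      rw [h1, h2]
    have hxq : x ∈ q := by
      rw [← hQq, hQQ]; exact hx
    exact Set.disjoint_left.mp hdq hxq (Submonoid.mem_sup_right (Submonoid.mem_powers x))
  have htxJ : algebraMap D S t * x ∈ J := by
    refine hJrad ⟨n + 1, ?_⟩
    have : (algebraMap D S t * x) ^ (n + 1) =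
        (algebraMap D S t ^ n * x) * (algebraMap D S t * x ^ n) := by ring
    rw [this]
    exact J.mul_mem_left _ htx
  have htsb : (t * s : B) * b ∈ D := by
    have h1 : (t : B) * (s * b - a) * 1 ∈ D := (hJ _).mp htxJ 1 S.one_mem
    have : (t * s : B) * b = (t : B) * (s * b - a) * 1 + t * a := by ring
    rw [this]
    exact D.add_mem h1 (D.mul_mem t.2 ha)
  let r : D := t * ⟨s, hs⟩
  have hsP : (⟨s, hs⟩ : D) ∉ P := by rw [← hQP]; exact hsQ
  have hrP : r ∉ P := fun h ↦ (hPp.mem_or_mem h).elim ht hsP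
  -- Since `r * b ∈ D` and `S` is finite over `D`, one power of `r` carries `S` into `D`; it lies in
  -- the conductor, hence in `P`, although `r ∉ P`.
  obtain ⟨m, hm⟩ := exists_pow_mul_mem_of_fg r.2 (hint b).fg_adjoin_singleton (fun y hy ↦ by
    rw [Subalgebra.mem_toSubmodule] at hy
    induction hy using Algebra.adjoin_induction with
    | mem y hy =>
      obtain rfl := hy
      exact ⟨1, by simpa [r] using htsb⟩
    | algebraMap z => exact ⟨0, by rw [pow_zero, one_mul]; exact z.2⟩
    | add y z _ _ hy hz =>
      obtain ⟨k, hk⟩ := hy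
      obtain ⟨l, hl⟩ := hz
      refine ⟨k + l, ?_⟩
      have : (r : B) ^ (k + l) * (y + z) = r ^ l * (r ^ k * y) + r ^ k * (r ^ l * z) := by ring
      rw [this]
      exact D.add_mem (D.mul_mem (D.pow_mem r.2 _) hk) (D.mul_mem (D.pow_mem r.2 _) hl)
    | mul y z _ _ hy hz =>
      obtain ⟨k, hk⟩ := hy
      obtain ⟨l, hl⟩ := hz
      refine ⟨k + l, ?_⟩
      have : (r : B) ^ (k + l) * (y * z) = (r ^ k * y) * (r ^ l * z) := by ring
      rw [this]
      exact D.mul_mem hk hl)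
  have : r ^ m ∈ I := (hI _).mpr fun y hy ↦ by simpa using hm y hy
  exact hrP (hPp.mem_of_pow_mem m (hP.1.2 this))

/-- Let `B → B'` be a ring map such that every element of the `ℚ`-algebra `B'` has a positive
multiple in the image, and let `D₀` be a subring of `B'` such that `B'` is integral over `D₀` with
the same spectrum and trivial residue field extensions. If `B` has an `A`-algebra structure such
that the preimage of `D₀` in `B` lies in the image of `A`, then `B` is integral over `A` and
`Spec B → Spec A` is injective on points with values in fields. -/
theorem isIntegral_and_injective_fieldPoints {A B B' : Type u} [CommRing A] [CommRing B]
    [CommRing B'] [Algebra ℚ B'] [Algebra A B] {i : B →+* B'} (D₀ : Subring B')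
    (hi : ∀ x : B', ∃ n : ℕ, n ≠ 0 ∧ ∃ b, i b = n * x)
    (hint : ∀ b : B', IsIntegral D₀ b)
    (hspec : ∀ P Q : Ideal B', P.IsPrime → Q.IsPrime → (∀ x ∈ D₀, x ∈ P ↔ x ∈ Q) → P = Q)
    (hres : ∀ (K : Type u) [Field K] (f g : B' →+* K), (∀ x ∈ D₀, f x = g x) → f = g)
    (hA : ∀ b, i b ∈ D₀ → b ∈ (algebraMap A B).range) (b : B) :
    IsIntegral A b ∧ ∀ (K : Type u) [Field K] (f g : B →+* K),
      f.comp (algebraMap A B) = g.comp (algebraMap A B) → f b = g b := by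
  let p : B → Prop := fun b ↦ IsIntegral A b ∧ ∀ (K : Type u) [Field K] (f g : B →+* K),
      f.comp (algebraMap A B) = g.comp (algebraMap A B) → f b = g b
  change p b
  obtain ⟨D, hD₀, hDmax⟩ := zorn_le_nonempty₀ {D : Subring B' | ∀ b, i b ∈ D → p b}
    (fun c hc hchain D hD ↦ ⟨sSup c, fun b hb ↦ by
      obtain ⟨E, hE, hbE⟩ := (Subring.mem_sSup_of_directedOn ⟨D, hD⟩ hchain.directedOn).mp hb
      exact hc hE b hbE, fun E hE ↦ le_sSup hE⟩) D₀ (fun b hb ↦ by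
      obtain ⟨a, rfl⟩ := hA b hb
      exact ⟨isIntegral_algebraMap, fun K _ f g h ↦ RingHom.congr_fun h a⟩)
  have hDp : ∀ b, i b ∈ D → p b := hDmax.1
  have htop : D = ⊤ := by
    refine D.eq_top_of_seminormal (fun b ↦ ?_)
      (fun P Q hP hQ h ↦ hspec P Q hP hQ fun x hx ↦ h x (hD₀ hx))
      (fun K _ f g h ↦ hres K f g fun x hx ↦ h x (hD₀ hx)) fun x h2 h3 ↦ ?_
    · obtain ⟨q, hq, hqb⟩ := hint b
      refine ⟨q.map (Subring.inclusion hD₀), hq.map _, ?_⟩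
      rw [Polynomial.eval₂_map]
      exact hqb
    · have hle : D ≤ Subring.closure (insert x (D : Set B')) := fun y hy ↦
        Subring.subset_closure (Set.mem_insert_of_mem _ hy)
      -- By maximality it suffices that `D[x]` still has the property; for `i b = α + β * x`, take
      -- `c = -(β * x)`.
      refine hDmax.2 (fun b hb ↦ ?_) hle (Subring.subset_closure (Set.mem_insert _ _))
      obtain ⟨α, hα, β, hβ, hb⟩ := exists_eq_add_mul_of_mem_closure_insert D h2 hb
      have h2' : (-(β * x)) ^ 2 ∈ D := by
        have : (-(β * x)) ^ 2 = β ^ 2 * x ^ 2 := by ring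
        rw [this]; exact D.mul_mem (D.pow_mem hβ 2) h2
      have h3' : (-(β * x)) ^ 3 ∈ D := by
        have : (-(β * x)) ^ 3 = -(β ^ 3 * x ^ 3) := by ring
        rw [this]; exact D.neg_mem (D.mul_mem (D.pow_mem hβ 3) h3)
      have hbc : i b + -(β * x) ∈ D := by rw [hb]; simpa using hα
      exact ⟨isIntegral_of_add_mem hi (fun b hb ↦ (hDp b hb).1) h2' h3' hbc,
        fun K _ f g h ↦ eq_of_add_mem hi (fun b hb ↦ (hDp b hb).2 K f g h) h2' h3' hbc⟩
  exact hDp b (htop ▸ Subring.mem_top _)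

/-! ### Universal homeomorphisms of affine schemes in terms of rings. -/

namespace IsUniversalHomeomorphism

variable {X Y : Scheme.{u}} {f : X ⟶ Y}

theorem universallyClosed (hf : IsUniversalHomeomorphism f) : UniversallyClosed f :=
  ⟨MorphismProperty.universally_mono
    (fun _ _ _ (h : IsHomeomorph _) ↦ h.isClosedMap) _ hf⟩

theorem universallyInjective (hf : IsUniversalHomeomorphism f) : UniversallyInjective f :=
  ⟨MorphismProperty.universally_mono
    (fun _ _ _ (h : IsHomeomorph _) ↦ h.injective) _ hf⟩

theorem surjective (hf : IsUniversalHomeomorphism f) : Surjective f :=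
  ⟨(hf _ _ _ .of_id_snd : IsHomeomorph f).surjective⟩

theorem of_integral [IsIntegralHom f] [UniversallyInjective f] [Surjective f] :
    IsUniversalHomeomorphism f := by
  intro X' Y' i₁ i₂ f' h
  have : IsIntegralHom f' := MorphismProperty.of_isPullback h.flip ‹_›
  have : UniversallyInjective f' := MorphismProperty.of_isPullback h.flip ‹_›
  have : Surjective f' := MorphismProperty.of_isPullback h.flip ‹_›
  exact isHomeomorph_iff_continuous_isClosedMap_bijective.mpr
    ⟨f'.continuous, f'.isClosedMap, f'.injective, f'.surjective⟩

end IsUniversalHomeomorphism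

section Spec

variable {R S : Type u} [CommRing R] [CommRing S] {φ : R →+* S}

theorem universallyInjective_specMap_iff :
    UniversallyInjective (Spec.map (CommRingCat.ofHom φ)) ↔
      ∀ (K : Type u) [Field K] (f g : S →+* K), f.comp φ = g.comp φ → f = g := by
  have := (tfae_universallyInjective (Spec.map (CommRingCat.ofHom φ))).out 0 1
  refine this.trans ?_
  refine forall₂_congr fun K _ ↦ ⟨fun h f g hfg ↦ ?_, fun h f g hfg ↦ ?_⟩
  · have := @h (Spec.map (CommRingCat.ofHom f)) (Spec.map (CommRingCat.ofHom g)) (by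
      simp only [← Spec.map_comp, ← CommRingCat.ofHom_comp, hfg])
    simpa using congr_arg CommRingCat.Hom.hom (Spec.map_injective this)
  · obtain ⟨f, rfl⟩ := Spec.map_surjective f
    obtain ⟨g, rfl⟩ := Spec.map_surjective g
    simp only [← Spec.map_comp] at hfg
    congr 1
    ext1
    exact h _ _ (congr_arg CommRingCat.Hom.hom (Spec.map_injective hfg))

theorem isUniversalHomeomorphism_specMap (hφ : φ.IsIntegral)
    (hres : ∀ (K : Type u) [Field K] (f g : S →+* K), f.comp φ = g.comp φ → f = g)
    (hker : RingHom.ker φ ≤ nilradical R) :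
    IsUniversalHomeomorphism (Spec.map (CommRingCat.ofHom φ)) := by
  have : IsIntegralHom (Spec.map (CommRingCat.ofHom φ)) := IsIntegralHom.SpecMap_iff.mpr hφ
  have := universallyInjective_specMap_iff.mpr hres
  have : Surjective (Spec.map (CommRingCat.ofHom φ)) := by
    have hint : φ.kerLift.IsIntegral := fun x ↦
      RingHom.IsIntegralElem.of_comp (f := Ideal.Quotient.mk (RingHom.ker φ)) (hφ x)
    exact ⟨(PrimeSpectrum.comap_quotientMk_bijective_of_le_nilradical hker).2.comp
      (hint.comap_surjective φ.kerLift_injective)⟩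
  exact .of_integral

variable (hφ : IsUniversalHomeomorphism (Spec.map (CommRingCat.ofHom φ)))
include hφ

namespace IsUniversalHomeomorphism

/-- An affine universally closed morphism is integral. -/
theorem ringHom_isIntegral : φ.IsIntegral :=
  have := hφ.universallyClosed
  (IsIntegralHom.SpecMap_iff (φ := CommRingCat.ofHom φ)).mp
    (IsIntegralHom.iff_universallyClosed_and_isAffineHom.mpr ⟨this, inferInstance⟩)

theorem ringHom_ext_field {K : Type u} [Field K] {f g : S →+* K}
    (h : f.comp φ = g.comp φ) : f = g :=
  universallyInjective_specMap_iff.mp hφ.universallyInjective K f g h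

theorem comap_injective : Function.Injective (PrimeSpectrum.comap φ) :=
  have := hφ.universallyInjective
  (Spec.map (CommRingCat.ofHom φ)).injective

theorem ker_le_nilradical : RingHom.ker φ ≤ nilradical R := by
  intro x hx
  rw [mem_nilradical, nilpotent_iff_mem_prime]
  intro P hP
  obtain ⟨Q, hQ⟩ := hφ.surjective.surj ⟨P, hP⟩
  have : x ∈ (PrimeSpectrum.comap φ Q).asIdeal := by
    change φ x ∈ Q.asIdeal
    rw [hx]; exact zero_mem _
  have hQ' : PrimeSpectrum.comap φ Q = ⟨P, hP⟩ := hQ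
  rwa [hQ'] at this

end IsUniversalHomeomorphism

end Spec

/-! ### The projection from the fibre product. -/

theorem exists_natCast_mul_eq_toRationalization (B : Type u) [CommRing B] (x : B ⊗[ℤ] ℚ) :
    ∃ n : ℕ, n ≠ 0 ∧ ∃ b, toRationalization B b = n * x := by
  induction x with
  | zero => exact ⟨1, one_ne_zero, 0, by simp⟩
  | tmul b q =>
    refine ⟨q.den, q.den_nz, q.num * b, ?_⟩
    have h1 : (q.den : B ⊗[ℤ] ℚ) = 1 ⊗ₜ (q.den : ℚ) := by
      rw [← map_natCast (Algebra.TensorProduct.includeRight : ℚ →ₐ[ℤ] B ⊗[ℤ] ℚ)]; rfl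
    rw [h1, Algebra.TensorProduct.tmul_mul_tmul, one_mul, Rat.den_mul_eq_num]
    change (q.num * b) ⊗ₜ[ℤ] (1 : ℚ) = _
    rw [← zsmul_eq_mul, TensorProduct.smul_tmul, zsmul_eq_mul, mul_one]
  | add x y hx hy =>
    obtain ⟨n, hn, b, hb⟩ := hx
    obtain ⟨m, hm, c, hc⟩ := hy
    refine ⟨n * m, mul_ne_zero hn hm, m * b + n * c, ?_⟩
    rw [map_add, map_mul, map_mul, hb, hc, map_natCast, map_natCast]
    push_cast
    ring

theorem isUniversalHomeomorphism_ringFibreProductFst {B A' : Type u} [CommRing B] [CommRing A']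
    {j : A' →+* B ⊗[ℤ] ℚ}
    (hj : IsUniversalHomeomorphism (Spec.map (CommRingCat.ofHom j))) :
    IsUniversalHomeomorphism
      (Spec.map (CommRingCat.ofHom (ringFibreProductFst (toRationalization B) j))) := by
  let φ : ringFibreProduct (toRationalization B) j →+* B :=
    ringFibreProductFst (toRationalization B) j
  let := φ.toAlgebra
  let : Algebra ℚ (B ⊗[ℤ] ℚ) :=
    (Algebra.TensorProduct.includeRight : ℚ →ₐ[ℤ] B ⊗[ℤ] ℚ).toRingHom.toAlgebra
  have key := isIntegral_and_injective_fieldPoints (A := ringFibreProduct (toRationalization B) j)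
    (i := toRationalization B) j.range (exists_natCast_mul_eq_toRationalization B) (fun b ↦ by
      obtain ⟨p, hp, hpb⟩ := hj.ringHom_isIntegral b
      refine ⟨p.map j.rangeRestrict, hp.map _, ?_⟩
      rw [Polynomial.eval₂_map]
      exact hpb)
    (fun P Q hP hQ h ↦ congr_arg PrimeSpectrum.asIdeal
      (hj.comap_injective (a₁ := ⟨P, hP⟩) (a₂ := ⟨Q, hQ⟩)
        (PrimeSpectrum.ext (Ideal.ext fun x ↦ h (j x) ⟨x, rfl⟩))))
    (fun K _ f g h ↦ hj.ringHom_ext_field (RingHom.ext fun x ↦ h (j x) ⟨x, rfl⟩))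
    (fun b ⟨a, ha⟩ ↦ ⟨⟨(b, a), ha.symm⟩, rfl⟩)
  refine isUniversalHomeomorphism_specMap (fun b ↦ (key b).1)
    (fun K _ f g h ↦ RingHom.ext fun b ↦ (key b).2 K f g h) ?_
  rintro ⟨⟨b, a⟩, hba⟩ h
  obtain rfl : b = 0 := h
  have ha : j a = 0 := by
    have : toRationalization B 0 = j a := hba
    rw [← this, map_zero]
  obtain ⟨n, hn⟩ := hj.ker_le_nilradical ha
  -- The exponent `n + 1` is positive, so that the component `0` in `B` also vanishes when `n = 0`.
  refine ⟨n + 1, Subtype.ext (Prod.ext ?_ ?_)⟩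
  · simp
  · have hn : a ^ n = 0 := hn
    simp [pow_succ, hn]

/-! ### The sheaf condition: localization and gluing. -/

theorem CommRingCat.isPullback_iff {X₁ X₂ X₃ X₄ : CommRingCat.{u}} {t : X₁ ⟶ X₂} {l : X₁ ⟶ X₃}
    {r : X₂ ⟶ X₄} {b : X₃ ⟶ X₄} :
    IsPullback t l r b ↔ t ≫ r = l ≫ b ∧ (∀ x y, t x = t y → l x = l y → x = y) ∧
      ∀ x y, r x = b y → ∃ z, t z = x ∧ l z = y := by
  refine ⟨fun h ↦ ?_, fun ⟨w, h₁, h₂⟩ ↦ ?_⟩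
  · obtain ⟨-, h₁, h₂⟩ := (Limits.Types.isPullback_iff _ _ _ _).mp (h.map (forget CommRingCat))
    exact ⟨h.w, fun x y hx hy ↦ h₁ x y ⟨hx, hy⟩, h₂⟩
  · refine .of_map (forget CommRingCat) w ((Limits.Types.isPullback_iff _ _ _ _).mpr ⟨?_, ?_, h₂⟩)
    · rw [← Functor.map_comp, w, Functor.map_comp]
    · exact fun x y h ↦ h₁ x y h.1 h.2

section Away

variable {A B A' B' : Type*} [CommRing A] [CommRing B] [CommRing A'] [CommRing B']
  {φ : A →+* B} {ψ : A →+* A'} {i : B →+* B'} {j : A' →+* B'}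
  {A₁ B₁ A₁' B₁' : Type*} [CommRing A₁] [CommRing B₁] [CommRing A₁'] [CommRing B₁']
  [Algebra A A₁] [Algebra B B₁] [Algebra A' A₁'] [Algebra B' B₁']
  {φ₁ : A₁ →+* B₁} {ψ₁ : A₁ →+* A₁'} {i₁ : B₁ →+* B₁'} {j₁ : A₁' →+* B₁'}
  (a : A) [IsLocalization.Away a A₁] [IsLocalization.Away (φ a) B₁]
  [IsLocalization.Away (ψ a) A₁']

include a

theorem eq_of_isLocalizationAway_of_jointly_injective
    (hφ : ∀ x, φ₁ (algebraMap A A₁ x) = algebraMap B B₁ (φ x))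
    (hψ : ∀ x, ψ₁ (algebraMap A A₁ x) = algebraMap A' A₁' (ψ x))
    (hinj : ∀ x y, φ x = φ y → ψ x = ψ y → x = y)
    {x y : A₁} (h₁ : φ₁ x = φ₁ y) (h₂ : ψ₁ x = ψ₁ y) : x = y := by
  obtain ⟨n, x', hx⟩ := IsLocalization.Away.surj a (x - y)
  have hu : IsUnit (algebraMap A A₁ a) := IsLocalization.Away.algebraMap_isUnit a
  have e₁ : algebraMap B B₁ (φ x') = algebraMap B B₁ 0 := by
    rw [← hφ, ← hx, map_mul, map_sub, h₁, sub_self, zero_mul, map_zero]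
  have e₂ : algebraMap A' A₁' (ψ x') = algebraMap A' A₁' 0 := by
    rw [← hψ, ← hx, map_mul, map_sub, h₂, sub_self, zero_mul, map_zero]
  obtain ⟨k, hk⟩ := IsLocalization.Away.exists_of_eq (φ a) e₁
  obtain ⟨l, hl⟩ := IsLocalization.Away.exists_of_eq (ψ a) e₂
  have h0 : a ^ (k + l) * x' = 0 := by
    apply hinj
    · rw [map_mul, map_pow, pow_add, mul_assoc, mul_left_comm, hk, mul_zero, mul_zero, map_zero]
    · rw [map_mul, map_pow, pow_add, mul_assoc, hl, mul_zero, mul_zero, map_zero]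
  have h1 : algebraMap A A₁ a ^ (k + l + n) * (x - y) = 0 := by
    rw [pow_add, mul_assoc, mul_comm _ (x - y), hx, ← map_pow, ← map_mul, h0, map_zero]
  exact sub_eq_zero.mp ((hu.pow _).mul_right_eq_zero.mp h1)

theorem exists_of_isLocalizationAway_of_fibreProduct [IsLocalization.Away (i (φ a)) B₁']
    (hφ : ∀ x, φ₁ (algebraMap A A₁ x) = algebraMap B B₁ (φ x))
    (hψ : ∀ x, ψ₁ (algebraMap A A₁ x) = algebraMap A' A₁' (ψ x))
    (hi : ∀ x, i₁ (algebraMap B B₁ x) = algebraMap B' B₁' (i x))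
    (hj : ∀ x, j₁ (algebraMap A' A₁' x) = algebraMap B' B₁' (j x))
    (hcomm : ∀ x, i (φ x) = j (ψ x))
    (hex : ∀ x y, i x = j y → ∃ z, φ z = x ∧ ψ z = y)
    {x : B₁} {y : A₁'} (h : i₁ x = j₁ y) : ∃ z, φ₁ z = x ∧ ψ₁ z = y := by
  obtain ⟨n, x', hx⟩ := IsLocalization.Away.surj (φ a) x
  obtain ⟨m, y', hy⟩ := IsLocalization.Away.surj (ψ a) y
  have e : algebraMap B' B₁' (i (φ a ^ m * x')) = algebraMap B' B₁' (j (ψ a ^ n * y')) := by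
    rw [← hi, ← hj, map_mul (algebraMap B B₁), map_mul (algebraMap A' A₁'), ← hx, ← hy]
    simp only [map_mul, map_pow, hi, hj, hcomm, h]
    ring
  obtain ⟨k, hk⟩ := IsLocalization.Away.exists_of_eq (i (φ a)) e
  -- The factor `a ^ k` makes the numerators agree in `B'`; `z` then represents `a ^ (k + m + n)`
  -- times the wanted element.
  obtain ⟨z, hz₁, hz₂⟩ := hex (φ a ^ (k + m) * x') (ψ a ^ (k + n) * y') (by
    rw [pow_add, pow_add, mul_assoc, mul_assoc, map_mul, map_mul j, map_pow, map_pow, ← hcomm, hk])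
  obtain ⟨u, hu⟩ : IsUnit (algebraMap A A₁ a) := IsLocalization.Away.algebraMap_isUnit a
  have huz : algebraMap A A₁ a ^ (k + m + n) * (↑(u⁻¹ ^ (k + m + n)) * algebraMap A A₁ z) =
      algebraMap A A₁ z := by
    rw [← hu, ← mul_assoc, ← Units.val_pow_eq_pow_val, ← Units.val_mul, ← mul_pow,
      mul_inv_cancel, one_pow, Units.val_one, one_mul]
  refine ⟨↑(u⁻¹ ^ (k + m + n)) * algebraMap A A₁ z, ?_, ?_⟩
  · have hv : IsUnit (algebraMap B B₁ (φ a)) := IsLocalization.Away.algebraMap_isUnit (φ a)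
    refine (hv.pow (k + m + n)).mul_left_cancel ?_
    have := congr_arg φ₁ huz
    rw [map_mul, map_pow, hφ, hφ, hz₁] at this
    rw [this, map_mul, ← hx, map_pow]
    ring
  · have hv : IsUnit (algebraMap A' A₁' (ψ a)) := IsLocalization.Away.algebraMap_isUnit (ψ a)
    refine (hv.pow (k + m + n)).mul_left_cancel ?_
    have := congr_arg ψ₁ huz
    rw [map_mul, map_pow, hψ, hψ, hz₂] at this
    rw [this, map_mul, ← hy, map_pow]
    ring

end Away

section Sections

theorem algebraMap_appLE_specMap {R S : CommRingCat.{u}} (φ : R ⟶ S)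
    (U : (Spec R).Opens) (V : (Spec S).Opens) (e : V ≤ Spec.map φ ⁻¹ᵁ U) (x : R) :
    (Spec.map φ).appLE U V e (algebraMap R Γ(Spec R, U) x) = algebraMap S Γ(Spec S, V) (φ x) := by
  have : (Scheme.ΓSpecIso R).inv ≫ (Spec R).presheaf.map (homOfLE le_top).op ≫
      (Spec.map φ).appLE U V e =
      φ ≫ (Scheme.ΓSpecIso S).inv ≫ (Spec S).presheaf.map (homOfLE le_top).op := by
    rw [Scheme.Hom.map_appLE, Scheme.ΓSpecIso_inv_naturality_assoc]
    simp [Scheme.Hom.appLE]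
  exact congr($(this).hom x)

theorem algebraMap_app_specMap {R S : CommRingCat.{u}} (φ : R ⟶ S) (U : (Spec R).Opens) (x : R) :
    (Spec.map φ).app U (algebraMap R Γ(Spec R, U) x) =
      algebraMap S Γ(Spec S, Spec.map φ ⁻¹ᵁ U) (φ x) := by
  rw [Scheme.Hom.app_eq_appLE]
  exact algebraMap_appLE_specMap φ _ _ _ x

theorem isLocalizationAway_sections {R : CommRingCat.{u}} (r : R) {U : (Spec R).Opens}
    (hU : U = PrimeSpectrum.basicOpen r) : IsLocalization.Away r Γ(Spec R, U) := by
  subst hU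
  infer_instance

variable {X Y X' Y' : Scheme.{u}} {p : Y ⟶ X} {g : Y ⟶ Y'} {f : X ⟶ X'} {q : Y' ⟶ X'}

theorem app_comp_app_eq_app_comp_appLE (comm : p ≫ f = g ≫ q) (U : X'.Opens)
    (e : p ⁻¹ᵁ f ⁻¹ᵁ U ≤ g ⁻¹ᵁ q ⁻¹ᵁ U) :
    f.app U ≫ p.app (f ⁻¹ᵁ U) = q.app U ≫ g.appLE (q ⁻¹ᵁ U) (p ⁻¹ᵁ f ⁻¹ᵁ U) e := by
  have h₁ : f.app U ≫ p.app (f ⁻¹ᵁ U) = (p ≫ f).appLE U (p ⁻¹ᵁ f ⁻¹ᵁ U) le_rfl := by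
    simp [Scheme.Hom.appLE]
  have h₂ : q.app U ≫ g.appLE (q ⁻¹ᵁ U) (p ⁻¹ᵁ f ⁻¹ᵁ U) e =
      (g ≫ q).appLE U (p ⁻¹ᵁ f ⁻¹ᵁ U) e := by
    simp [Scheme.Hom.appLE]
  rw [h₁, h₂]
  simp only [comm]

theorem isPullback_sections_of_isBasis (comm : p ≫ f = g ≫ q)
    (e : ∀ U : X'.Opens, p ⁻¹ᵁ f ⁻¹ᵁ U ≤ g ⁻¹ᵁ q ⁻¹ᵁ U)
    {𝓑 : Set X'.Opens} (h𝓑 : TopologicalSpace.Opens.IsBasis 𝓑)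
    (h : ∀ U ∈ 𝓑, IsPullback (f.app U) (q.app U) (p.app (f ⁻¹ᵁ U))
      (g.appLE (q ⁻¹ᵁ U) (p ⁻¹ᵁ f ⁻¹ᵁ U) (e U))) (U : X'.Opens) :
    IsPullback (f.app U) (q.app U) (p.app (f ⁻¹ᵁ U))
      (g.appLE (q ⁻¹ᵁ U) (p ⁻¹ᵁ f ⁻¹ᵁ U) (e U)) := by
  simp only [CommRingCat.isPullback_iff] at h
  have fres : ∀ {U V : X'.Opens} (k : V ≤ U) (x : Γ(X', U)),
      f.app V (X'.presheaf.map (homOfLE k).op x) =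
        X.presheaf.map (homOfLE (f.preimage_mono k)).op (f.app U x) := fun k x ↦
    congr($(f.naturality (homOfLE k).op).hom x)
  have qres : ∀ {U V : X'.Opens} (k : V ≤ U) (x : Γ(X', U)),
      q.app V (X'.presheaf.map (homOfLE k).op x) =
        Y'.presheaf.map (homOfLE (q.preimage_mono k)).op (q.app U x) := fun k x ↦
    congr($(q.naturality (homOfLE k).op).hom x)
  have cover : ∀ U : X'.Opens, U ≤ ⨆ V : {V // V ∈ 𝓑 ∧ V ≤ U}, V.1 := fun U x hx ↦ by
    obtain ⟨V, hV, hxV, hVU⟩ := TopologicalSpace.Opens.isBasis_iff_nbhd.mp h𝓑 hx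
    exact TopologicalSpace.Opens.mem_iSup.mpr ⟨⟨V, hV, hVU⟩, hxV⟩
  -- Injectivity is needed on every open, since gluing compares sections on intersections that need
  -- not belong to `𝓑`.
  have inj : ∀ (U : X'.Opens) (x y : Γ(X', U)), f.app U x = f.app U y → q.app U x = q.app U y →
      x = y := fun U x y hf hq ↦ by
    refine X'.sheaf.eq_of_locally_eq' (fun V : {V // V ∈ 𝓑 ∧ V ≤ U} ↦ V.1) U
      (fun V ↦ homOfLE V.2.2) (cover U) x y fun V ↦ ?_
    refine (h V.1 V.2.1).2.1 _ _ ?_ ?_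
    · exact (fres V.2.2 x).trans ((congr_arg _ hf).trans (fres V.2.2 y).symm)
    · exact (qres V.2.2 x).trans ((congr_arg _ hq).trans (qres V.2.2 y).symm)
  refine CommRingCat.isPullback_iff.mpr
    ⟨app_comp_app_eq_app_comp_appLE comm U (e U), inj U, fun s t hst ↦ ?_⟩
  have hloc : ∀ V : {V // V ∈ 𝓑 ∧ V ≤ U}, ∃ z : Γ(X', V.1),
      f.app V.1 z = X.presheaf.map (homOfLE (f.preimage_mono V.2.2)).op s ∧
      q.app V.1 z = Y'.presheaf.map (homOfLE (q.preimage_mono V.2.2)).op t := fun V ↦ by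
    refine (h V.1 V.2.1).2.2 _ _ ?_
    have h₁ : p.app (f ⁻¹ᵁ V.1) (X.presheaf.map (homOfLE (f.preimage_mono V.2.2)).op s) =
        Y.presheaf.map (homOfLE (p.preimage_mono (f.preimage_mono V.2.2))).op
          (p.app (f ⁻¹ᵁ U) s) :=
      congr($(p.naturality (homOfLE (f.preimage_mono V.2.2)).op).hom s)
    have h₂ : Y'.presheaf.map (homOfLE (q.preimage_mono V.2.2)).op ≫
        g.appLE (q ⁻¹ᵁ V.1) (p ⁻¹ᵁ f ⁻¹ᵁ V.1) (e V.1) =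
        g.appLE (q ⁻¹ᵁ U) (p ⁻¹ᵁ f ⁻¹ᵁ U) (e U) ≫
          Y.presheaf.map (homOfLE (p.preimage_mono (f.preimage_mono V.2.2))).op := by
      rw [Scheme.Hom.map_appLE, Scheme.Hom.appLE_map]
    rw [h₁, hst]
    exact congr($(h₂).hom t).symm
  choose z hz₁ hz₂ using hloc
  have hres : ∀ {F : Scheme.{u}} {U V W : F.Opens} (k : V ≤ U) (l : W ≤ V) (x : Γ(F, U)),
      F.presheaf.map (homOfLE l).op (F.presheaf.map (homOfLE k).op x) =
        F.presheaf.map (homOfLE (l.trans k)).op x := fun {F U V W} k l x ↦ by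
    rw [← CommRingCat.comp_apply, ← Functor.map_comp]; rfl
  obtain ⟨w, hw, -⟩ := X'.sheaf.existsUnique_gluing' (fun V : {V // V ∈ 𝓑 ∧ V ≤ U} ↦ V.1) U
    (fun V ↦ homOfLE V.2.2) (cover U) z (fun V W ↦ by
      refine inj _ _ _ ?_ ?_
      · refine (fres inf_le_left (z V)).trans (Eq.trans ?_ (fres inf_le_right (z W)).symm)
        rw [hz₁, hz₁, hres, hres]
      · refine (qres inf_le_left (z V)).trans (Eq.trans ?_ (qres inf_le_right (z W)).symm)
        rw [hz₂, hz₂, hres, hres])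
  have hcov : ∀ {F : Scheme.{u}} (k : F ⟶ X'),
      k ⁻¹ᵁ U ≤ ⨆ V : {V // V ∈ 𝓑 ∧ V ≤ U}, k ⁻¹ᵁ V.1 := fun k x hx ↦ by
    obtain ⟨V, hV⟩ := TopologicalSpace.Opens.mem_iSup.mp (cover U hx)
    exact TopologicalSpace.Opens.mem_iSup.mpr ⟨V, hV⟩
  refine ⟨w, ?_, ?_⟩
  · refine X.sheaf.eq_of_locally_eq' (fun V : {V // V ∈ 𝓑 ∧ V ≤ U} ↦ f ⁻¹ᵁ V.1) (f ⁻¹ᵁ U)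
      (fun V ↦ homOfLE (f.preimage_mono V.2.2)) (hcov f) _ _ fun V ↦ ?_
    exact (fres V.2.2 w).symm.trans ((congr_arg _ (hw V)).trans (hz₁ V))
  · refine Y'.sheaf.eq_of_locally_eq' (fun V : {V // V ∈ 𝓑 ∧ V ≤ U} ↦ q ⁻¹ᵁ V.1) (q ⁻¹ᵁ U)
      (fun V ↦ homOfLE (q.preimage_mono V.2.2)) (hcov q) _ _ fun V ↦ ?_
    exact (qres V.2.2 w).symm.trans ((congr_arg _ (hw V)).trans (hz₂ V))

end Sections

theorem isPullback_ringFibreProduct {R S T : Type u} [CommRing R] [CommRing S] [CommRing T]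
    (φ : R →+* T) (ψ : S →+* T) :
    IsPullback (CommRingCat.ofHom (ringFibreProductFst φ ψ))
      (CommRingCat.ofHom (ringFibreProductSnd φ ψ)) (CommRingCat.ofHom φ) (CommRingCat.ofHom ψ) :=
  CommRingCat.isPullback_iff.mpr ⟨CommRingCat.hom_ext (RingHom.ext fun x ↦ x.2),
    fun _ _ h₁ h₂ ↦ Subtype.ext (Prod.ext h₁ h₂), fun x y h ↦ ⟨⟨(x, y), h⟩, rfl, rfl⟩⟩

theorem isPullback_sections_basicOpen_of_isPullback {R₁ R₂ R₃ R₄ : CommRingCat.{u}} {t : R₁ ⟶ R₂}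
    {l : R₁ ⟶ R₃} {r : R₂ ⟶ R₄} {b : R₃ ⟶ R₄} (h : IsPullback t l r b) (a : R₁)
    {U : (Spec R₁).Opens} (hU : U = PrimeSpectrum.basicOpen a)
    (e : Spec.map r ⁻¹ᵁ Spec.map t ⁻¹ᵁ U ≤ Spec.map b ⁻¹ᵁ Spec.map l ⁻¹ᵁ U) :
    IsPullback ((Spec.map t).app U) ((Spec.map l).app U) ((Spec.map r).app _)
      ((Spec.map b).appLE _ _ e) := by
  have := isLocalizationAway_sections a hU
  have := isLocalizationAway_sections (t.hom a) (U := Spec.map t ⁻¹ᵁ U) (by rw [hU]; rfl)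
  have := isLocalizationAway_sections (l.hom a) (U := Spec.map l ⁻¹ᵁ U) (by rw [hU]; rfl)
  have := isLocalizationAway_sections (r.hom (t.hom a))
    (U := Spec.map r ⁻¹ᵁ Spec.map t ⁻¹ᵁ U) (by rw [hU]; rfl)
  have hcomm : Spec.map r ≫ Spec.map t = Spec.map b ≫ Spec.map l := by
    rw [← Spec.map_comp, ← Spec.map_comp, h.w]
  obtain ⟨-, hinj, hex⟩ := CommRingCat.isPullback_iff.mp h
  refine CommRingCat.isPullback_iff.mpr
    ⟨app_comp_app_eq_app_comp_appLE hcomm U e, fun x y hx hy ↦ ?_, fun x y hxy ↦ ?_⟩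
  · exact eq_of_isLocalizationAway_of_jointly_injective a (φ := t.hom) (ψ := l.hom)
      (φ₁ := ((Spec.map t).app U).hom) (ψ₁ := ((Spec.map l).app U).hom)
      (algebraMap_app_specMap t U) (algebraMap_app_specMap l U) hinj hx hy
  · exact exists_of_isLocalizationAway_of_fibreProduct a
      (φ := t.hom) (ψ := l.hom) (i := r.hom) (j := b.hom)
      (φ₁ := ((Spec.map t).app U).hom) (ψ₁ := ((Spec.map l).app U).hom)
      (i₁ := ((Spec.map r).app _).hom) (j₁ := ((Spec.map b).appLE _ _ e).hom)
      (algebraMap_app_specMap t U) (algebraMap_app_specMap l U)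
      (algebraMap_app_specMap r _) (algebraMap_appLE_specMap b _ _ _)
      (fun x ↦ congr($(h.w).hom x)) hex hxy

theorem mainTheorem9 (B A' : Type u) [CommRing B] [CommRing A'] [Algebra ℚ A']
    (j : A' →+* B ⊗[ℤ] ℚ)
    (hj : IsUniversalHomeomorphism (Spec.map (CommRingCat.ofHom j))) :
    IsUniversalHomeomorphism
      (Spec.map (CommRingCat.ofHom (ringFibreProductFst (toRationalization B) j))) ∧
    IsGeometricPushoutSquare
      (Spec.map (CommRingCat.ofHom (toRationalization B)))
      (Spec.map (CommRingCat.ofHom j))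
      (Spec.map (CommRingCat.ofHom (ringFibreProductFst (toRationalization B) j)))
      (Spec.map (CommRingCat.ofHom (ringFibreProductSnd (toRationalization B) j))) := by
  have huh := isUniversalHomeomorphism_ringFibreProductFst hj
  have hpb := isPullback_ringFibreProduct (toRationalization B) j
  have hcomm := congr(Spec.map $(hpb.w))
  rw [Spec.map_comp, Spec.map_comp] at hcomm
  refine ⟨huh, ⟨hcomm, inferInstance, inferInstance, hj, huh⟩, ?_⟩
  refine isPullback_sections_of_isBasis hcomm _ PrimeSpectrum.isBasis_basic_opens ?_
  rintro _ ⟨a, rfl⟩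
  exact isPullback_sections_basicOpen_of_isPullback hpb a rfl _
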